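/- **Definitions.** Write $\mathbb N_n=\{0,\dots,n-1\}$ for $n\ge 1$. A *network* is a finite undirected graph $G=(V,E)$ (loops allowed) with a label $\ell(u,v)\in\mathbb N$ for every ordered pair with $\{u,v\}\in E$; it is *unlabeled* if all labels are equal. Automorphisms of $G$ are the permutations of $V$ that preserve adjacency and labels. An *arrangement* of $k\ge 1$ robots is a map $a:\mathbb N_k\to V$. Two arrangements $a_1,a_2$ are *equivalent under* $(\alpha,\pi)$, where $\alpha$ is an automorphism and $\pi$ a permutation of $\mathbb N_k$, if $\alpha\circ a_1=a_2\circ\pi$. A *configuration* is an equivalence class of arrangements, and $\mathcal C(G,k)$ is the set of configurations. Vertices $v,v'$ are *equivalent in $a$* if $\alpha(v)=v'$ for some $(\alpha,\pi)$ under which $a$ is equivalent to itself. A *class of indistinguishable vertices* $U$ of a configuration $C$ assigns to each $a\in C$ an equivalence class $U(a)$ of vertices of $a$, such that $\alpha(U(a_1))=U(a_2)$ whenever $a_1,a_2\in C$ are equivalent under $(\alpha,\pi)$. An *algorithm* maps each pair $(C,U)$, with $C\in\mathcal C(G,k)$ and $U$ a class of indistinguishable vertices of $C$, to a class $U'=A(C,U)$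 of indistinguishable vertices of $C$, such that for all $a\in C$ and $u\in U(a)$ there is $u'\in U'(a)$ equal or adjacent to $u$. A configuration $C'$ *yields* from $C$ under $A$ if for every $a\in C$ there is $a'\in C'$ such that, for every robot $r$, $a'(r)$ is equal or adjacent to $a(r)$, and $a'(r)\in A(C,U)(a)$ for the class $U$ with $a(r)\in U(a)$. An *execution* is a sequence $(C_i)_{i\ge 0}$ of configurations. A *system* $(G,k,S)$ consists of a network, a number $k\ge1$ of robots, and a scheduler $S$, i.e. a relation between algorithms and executions. The executions of $A$ under a system are those related to $A$ by its scheduler. Under the *fully synchronous scheduler* $\mathcal F$, the executions of $A$ are the sequences in which $C_{i+1}$ yields from $C_i$ for every $i$. An algorithm $A$ under a system $(G,k,S)$ *simulates* an algorithm $A'$ under $(G',k',S')$ if there is a surjective partial function $\varphi:\mathcal C(G,k)\to\mathcal C(G',k')$ such that for each execution $(C_i)$ of $A$ there is an execution $(C'_i)$ of $A'$ for which either $\varphi(C_0)$ is undefined, or there is a weakly increasing surjection $\sigma:\mathbb N\to\mathbb N$ such that, for all $i$, $\varphi(C_i)$ is defined and equals $C'_{\sigma(i)}$. For $f:\mathbb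 N_m\to\mathbb N_m$ let $\Gamma_f$ be the network with vertex set $\mathbb N_m$, edges $\{x,f(x)\}$ (a loop if $f(x)=x$) and labels $\ell(u,v)=v$, and let $A_f$ be the algorithm for one robot on $\Gamma_f$ that always moves the robot from its vertex $x$ to $f(x)$. A system *computes* $f$ if some algorithm under it simulates $A_f$ under $(\Gamma_f,1,\mathcal F)$. A set of systems is *universal* if for every $m\ge1$ every function $f:\mathbb N_m\to\mathbb N_m$ is computed by some system in the set. Let $OP_n^k$ and $UP_n^k$ ($n\ge 1$) be the systems of $k$ robots under $\mathcal F$ on the path with $n$ vertices which is, respectively, oriented (the labels at each vertex tell the left neighbor from the right neighbor, consistently along the path) and unlabeled. Let $OR_n^k$ and $UR_n^k$ ($n\ge 3$) be the systems of $k$ robots under $\mathcal F$ on the cycle with $n$ vertices which is, respectively, oriented (the labels at each vertex tell the clockwise neighbor from the counterclockwise one, consistently along the cycle) and unlabeled. **Theorem.** Each of the four sets of systems $\{OP_n^2\mid n\ge1\}$, $\{UP_n^2\mid n\ge 1\}$, $\{OR_n^2\mid n\ge3\}$ and $\{UR_n^3\mid n\ge3\}$ is universal. -/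

import Mathlib

namespace ObliviousRobots

/-- A labeled graph (network) on the vertex set `V`: an undirected graph, in which loops are
allowed, with a label `label u v` on every ordered pair of adjacent vertices.  The value of
`label` on pairs of non-adjacent vertices is never used. -/
structure Network (V : Type) where
  Adj : V → V → Prop
  symm : ∀ u v, Adj u v → Adj v u
  label : V → V → ℕ

variable {V : Type}

/-- Automorphisms of a network: permutations of the vertices that preserve adjacency and labels.
(On a finite graph it is the same to require only that adjacent pairs go to adjacent pairs.) -/
def Network.IsAutomorphism (G : Network V) (α : Equiv.Perm V) : Prop :=
  (∀ u v, G.Adj u v ↔ G.Adj (α u) (α v)) ∧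
    ∀ u v, G.Adj u v → G.label u v = G.label (α u) (α v)

/-- An arrangement of `k` (distinguishable) robots on the vertices. -/
abbrev Arrangement (V : Type) (k : ℕ) : Type := Fin k → V

/-- The arrangements `a₁` and `a₂` are equivalent under the automorphism `α` and the permutation
`π` of the robots. -/
def EquivUnder (G : Network V) {k : ℕ} (a₁ a₂ : Arrangement V k)
    (α : Equiv.Perm V) (π : Equiv.Perm (Fin k)) : Prop :=
  G.IsAutomorphism α ∧ α ∘ a₁ = a₂ ∘ π

/-- Equivalence of arrangements. -/
def arrangementSetoid (G : Network V) (k : ℕ) : Setoid (Arrangement V k) where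
  r a₁ a₂ := ∃ α π, EquivUnder G a₁ a₂ α π
  iseqv :=
    { refl := fun a => ⟨1, 1, ⟨fun _ _ => Iff.rfl, fun _ _ _ => rfl⟩, rfl⟩
      symm := by
        rintro a b ⟨α, π, ⟨h₁, h₂⟩, h⟩
        have hα : ∀ u, α (α.symm u) = u := α.apply_symm_apply
        refine ⟨α.symm, π.symm, ⟨fun u v => ?_, fun u v huv => ?_⟩, ?_⟩
        · have h' := h₁ (α.symm u) (α.symm v)
          rw [hα, hα] at h'
          exact h'.symm
        · have h' := h₁ (α.symm u) (α.symm v)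
          have h'' := h₂ (α.symm u) (α.symm v)
          rw [hα, hα] at h' h''
          exact (h'' (h'.mpr huv)).symm
        · funext r
          have h' := congrFun h (π.symm r)
          simp only [Function.comp_apply, Equiv.apply_symm_apply] at h'
          simp [← h']
      trans := by
        rintro a b c ⟨α, π, ⟨h₁, h₂⟩, h⟩ ⟨β, ρ, ⟨g₁, g₂⟩, g⟩
        refine ⟨β * α, ρ * π, ⟨fun u v => (h₁ u v).trans (g₁ _ _), fun u v huv => ?_⟩, ?_⟩
        · exact (h₂ u v huv).trans (g₂ _ _ ((h₁ u v).mp huv))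
        · funext r
          have e₁ := congrFun h r
          have e₂ := congrFun g (π r)
          simp only [Function.comp_apply] at e₁ e₂
          simp [e₁, e₂] }

/-- The configuration space of `k` robots on `G`. -/
abbrev Configuration (G : Network V) (k : ℕ) : Type := Quotient (arrangementSetoid G k)

/-- The configuration of an arrangement. -/
abbrev Network.conf (G : Network V) {k : ℕ} (a : Arrangement V k) : Configuration G k :=
  Quotient.mk (arrangementSetoid G k) a

/-- Equivalent vertices in an arrangement `a`. -/
def VertexEquiv (G : Network V) {k : ℕ} (a : Arrangement V k) (v v' : V) : Prop :=
  ∃ α π, EquivUnder G a a α π ∧ α v = v'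

/-- A class of indistinguishable vertices of a configuration `C`: it picks in every arrangement
`a ∈ C` an equivalence class of vertices of `a`, compatibly with all equivalences between
arrangements. -/
@[ext]
structure VertexClass (G : Network V) {k : ℕ} (C : Configuration G k) where
  carrier : {a : Arrangement V k // G.conf a = C} → Set V
  isClass : ∀ a, ∃ v, carrier a = {v' | VertexEquiv G a.1 v v'}
  equivariant : ∀ a₁ a₂ α π, EquivUnder G a₁.1 a₂.1 α π → α '' carrier a₁ = carrier a₂

/-- An algorithm for `k` robots on `G`: from the current configuration and the class of
indistinguishable vertices in which the executing robot lies, it computes a class of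
indistinguishable vertices as the destination. -/
structure Algorithm (G : Network V) (k : ℕ) where
  dest : ∀ C : Configuration G k, VertexClass G C → VertexClass G C
  reachable : ∀ (C : Configuration G k) (U : VertexClass G C) a, ∀ u ∈ U.carrier a,
    ∃ u' ∈ (dest C U).carrier a, u = u' ∨ G.Adj u u'

/-- Executions are sequences of configurations. -/
abbrev Execution (G : Network V) (k : ℕ) : Type := ℕ → Configuration G k

/-- A scheduler is a relation between algorithms and executions. -/
abbrev Scheduler (G : Network V) (k : ℕ) : Type := Algorithm G k → Execution G k → Prop

/-- `C'` yields from `C` under the algorithm `A`: every robot moves, by at most one hop, to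
some vertex of the destination class that it computes. -/
def Yields {G : Network V} {k : ℕ} (A : Algorithm G k) (C C' : Configuration G k) : Prop :=
  ∀ a : {a : Arrangement V k // G.conf a = C}, ∃ a' : Arrangement V k, G.conf a' = C' ∧
    ∀ r, (a.1 r = a' r ∨ G.Adj (a.1 r) (a' r)) ∧
      ∀ U : VertexClass G C, a.1 r ∈ U.carrier a → a' r ∈ (A.dest C U).carrier a

/-- The fully synchronous scheduler. -/
def fullySynchronous (G : Network V) (k : ℕ) : Scheduler G k :=
  fun A E => ∀ i, Yields A (E i) (E (i + 1))

/-- A system of oblivious mobile robots: a finite network, a positive number of robots and a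
scheduler. -/
structure System where
  Vertex : Type
  finite : Finite Vertex
  network : Network Vertex
  robots : ℕ
  robots_pos : 1 ≤ robots
  scheduler : Scheduler network robots

/-- The algorithms for the robots of a system. -/
abbrev System.Algo (Ψ : System) : Type := Algorithm Ψ.network Ψ.robots

/-- The configurations of a system. -/
abbrev System.Conf (Ψ : System) : Type := Configuration Ψ.network Ψ.robots

/-- The system of `k ≥ 1` robots on `G` under the fully synchronous scheduler. -/
def fullySynchronousSystem [hV : Finite V] (G : Network V) (k : ℕ) [hk : NeZero k] : System where
  Vertex := V
  finite := hV
  network := G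
  robots := k
  robots_pos := Nat.one_le_iff_ne_zero.mpr hk.out
  scheduler := fullySynchronous G k

/-- Compliance of the execution `E` with the execution `E'` under a partial function `φ`
(where `none` stands for "undefined"). -/
def Compliant {X Y : Type} (φ : X → Option Y) (E : ℕ → X) (E' : ℕ → Y) : Prop :=
  φ (E 0) = none ∨
    ∃ σ : ℕ → ℕ, Monotone σ ∧ Function.Surjective σ ∧ ∀ i, φ (E i) = some (E' (σ i))

/-- The algorithm `A` under the system `Ψ` simulates the algorithm `A'` under the
system `Ψ'`. -/
def Simulates (Ψ : System) (A : Ψ.Algo) (Ψ' : System) (A' : Ψ'.Algo) : Prop :=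
  ∃ φ : Ψ.Conf → Option Ψ'.Conf, (∀ D, ∃ C, φ C = some D) ∧
    ∀ E : ℕ → Ψ.Conf, Ψ.scheduler A E →
      ∃ E' : ℕ → Ψ'.Conf, Ψ'.scheduler A' E' ∧ Compliant φ E E'

/-- The network induced by a function: the edges are the pairs `{x, f x}` (a loop where
`f x = x`), and the label on `(u, v)` is `v`. -/
def inducedNetwork {n : ℕ} (f : Fin n → Fin n) : Network (Fin n) where
  Adj u v := v = f u ∨ u = f v
  symm _ _ h := h.symm
  label _ v := v

theorem inducedNetwork_automorphism {n : ℕ} {f : Fin n → Fin n} {α : Equiv.Perm (Fin n)}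
    (h : (inducedNetwork f).IsAutomorphism α) : α = 1 := by
  ext v
  exact (h.2 (f v) v (Or.inr rfl)).symm

theorem inducedNetwork_vertexEquiv {n k : ℕ} {f : Fin n → Fin n} (a : Arrangement (Fin n) k)
    (v v' : Fin n) : VertexEquiv (inducedNetwork f) a v v' ↔ v = v' := by
  constructor
  · rintro ⟨α, π, h, rfl⟩
    rw [inducedNetwork_automorphism h.1]
    rfl
  · rintro rfl
    exact ⟨1, 1, ⟨⟨fun _ _ => Iff.rfl, fun _ _ _ => rfl⟩, rfl⟩, rfl⟩

/-- The algorithm associated to `f`, for one robot on the network induced by `f`: the robot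
always moves from its current vertex `x` to `f x`.  (Classes of indistinguishable vertices are
singletons here.) -/
def associatedAlgorithm {n : ℕ} (f : Fin n → Fin n) : Algorithm (inducedNetwork f) 1 where
  dest C U :=
    { carrier := fun a => f '' U.carrier a
      isClass := by
        intro a
        obtain ⟨v, hv⟩ := U.isClass a
        refine ⟨f v, ?_⟩
        rw [hv]
        ext w
        simp only [inducedNetwork_vertexEquiv, Set.mem_image, Set.mem_ofPred_eq, exists_eq_left']
      equivariant := by
        intro a₁ a₂ α π h
        have h' := U.equivariant a₁ a₂ α π h
        have hα := inducedNetwork_automorphism h.1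
        subst hα
        simp only [Equiv.Perm.coe_one, Set.image_id] at h' ⊢
        rw [h'] }
  reachable C U a u hu := ⟨f u, ⟨u, hu, rfl⟩, Or.inr (Or.inl rfl)⟩

/-- The system `Ψ` computes the function `f` on `{0, …, n - 1}`: some algorithm under `Ψ`
simulates the algorithm associated to `f`. -/
def Computes (Ψ : System) {n : ℕ} (f : Fin n → Fin n) : Prop :=
  ∃ A : Ψ.Algo, Simulates Ψ A (fullySynchronousSystem (inducedNetwork f) 1) (associatedAlgorithm f)

/-- A set of systems is universal if every function from `{0, …, n - 1}` to itself, `n ≥ 1`, is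
computed by one of its members. -/
def Universal (Υ : Set System) : Prop :=
  ∀ n : ℕ, 1 ≤ n → ∀ f : Fin n → Fin n, ∃ Ψ ∈ Υ, Computes Ψ f

/-- A simple graph with a labeling, as a network. -/
def ofSimpleGraph (H : SimpleGraph V) (ℓ : V → V → ℕ) : Network V where
  Adj := H.Adj
  symm _ _ h := h.symm
  label := ℓ

/-- `k` fully synchronous robots on the oriented path with `n` vertices: the label is `1` towards
the right and `0` towards the left. -/
def orientedPath (n k : ℕ) [NeZero k] : System :=
  fullySynchronousSystem
    (ofSimpleGraph (SimpleGraph.pathGraph n) fun u v => if u < v then 1 else 0) k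

/-- `k` fully synchronous robots on the unoriented (unlabeled) path with `n` vertices. -/
def unorientedPath (n k : ℕ) [NeZero k] : System :=
  fullySynchronousSystem (ofSimpleGraph (SimpleGraph.pathGraph n) fun _ _ => 0) k

/-- `k` fully synchronous robots on the oriented ring with `n ≥ 3` vertices: the label is `1` in
the clockwise direction and `0` in the counterclockwise direction. -/
def orientedRing (n k : ℕ) [NeZero k] : System :=
  fullySynchronousSystem
    (ofSimpleGraph (SimpleGraph.cycleGraph n) fun u v =>
      if v.val = (u.val + 1) % n then 1 else 0) k

/-- `k` fully synchronous robots on the unoriented (unlabeled) ring with `n ≥ 3` vertices. -/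
def unorientedRing (n k : ℕ) [NeZero k] : System :=
  fullySynchronousSystem (ofSimpleGraph (SimpleGraph.cycleGraph n) fun _ _ => 0) k

end ObliviousRobots

open ObliviousRobots

namespace ObliviousRobots
variable {V : Type}

/-! The iterates of `f` form an eventually periodic sequence, so "apply `f`" lifts to a map `F` on
pairs (starting point, time). The orbit of each starting point is a tail running into a cycle.
Folding the cycle flat, with the way out on even integers and the way back on odd ones, places all
pairs on a line so that `F` moves every position by at most 2 (`exists_line_semiconj`).

A position `p` is encoded by two robots at distance `p + 2`. Each robot accounts for about half of
that distance, so a change of `p` by at most 2 moves each robot by at most one edge (`coord_step`).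

The robots can tell where they are if the arrangements used are rigid: no nontrivial automorphism
relates them and no two represent the same configuration. Then vertex classes are singletons, each
robot knows its role, and the fully synchronous successor is forced (`computes_of_isRigid`). On a
path, rigidity holds because all robots stay in one half. On an oriented ring, labels exclude
reflections and the distance excludes rotations. On an unlabeled ring, a third robot adjacent to the
second makes the two gaps 1 and `p + 2` unequal, which excludes reflections. -/

/-! ### Equivalences of arrangements and vertex classes. -/

theorem EquivUnder.refl (G : Network V) {k : ℕ} (a : Arrangement V k) : EquivUnder G a a 1 1 :=
  ⟨⟨fun _ _ => Iff.rfl, fun _ _ _ => rfl⟩, rfl⟩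

theorem EquivUnder.trans {G : Network V} {k : ℕ} {a b c : Arrangement V k}
    {α β : Equiv.Perm V} {π ρ : Equiv.Perm (Fin k)} (h : EquivUnder G a b α π)
    (g : EquivUnder G b c β ρ) : EquivUnder G a c (β * α) (ρ * π) := by
  obtain ⟨⟨h₁, h₂⟩, h⟩ := h
  obtain ⟨⟨g₁, g₂⟩, g⟩ := g
  refine ⟨⟨fun u v => (h₁ u v).trans (g₁ _ _), fun u v huv =>
    (h₂ u v huv).trans (g₂ _ _ ((h₁ u v).mp huv))⟩, ?_⟩
  funext r
  have e₁ := congrFun h r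
  have e₂ := congrFun g (π r)
  simp only [Function.comp_apply] at e₁ e₂
  simp [e₁, e₂]

theorem EquivUnder.symm {G : Network V} {k : ℕ} {a b : Arrangement V k}
    {α : Equiv.Perm V} {π : Equiv.Perm (Fin k)} (h : EquivUnder G a b α π) :
    EquivUnder G b a α⁻¹ π⁻¹ := by
  obtain ⟨⟨h₁, h₂⟩, h⟩ := h
  refine ⟨⟨fun u v => ?_, fun u v huv => ?_⟩, ?_⟩
  · simpa using (h₁ (α⁻¹ u) (α⁻¹ v)).symm
  · have h' := h₁ (α⁻¹ u) (α⁻¹ v)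
    have h'' := h₂ (α⁻¹ u) (α⁻¹ v)
    simp only [Equiv.Perm.inv_def, Equiv.apply_symm_apply] at h' h''
    exact (h'' (h'.mpr huv)).symm
  · funext r
    have h' := congrFun h (π⁻¹ r)
    simp only [Function.comp_apply, Equiv.Perm.inv_def, Equiv.apply_symm_apply] at h'
    simp [← h']

theorem conf_eq_iff {G : Network V} {k : ℕ} {a b : Arrangement V k} :
    G.conf a = G.conf b ↔ ∃ α π, EquivUnder G a b α π :=
  Quotient.eq (r := arrangementSetoid G k)

/-- The class of indistinguishable vertices that contains the vertex `v` of the arrangement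
`a₀`. -/
def VertexClass.of (G : Network V) {k : ℕ} {C : Configuration G k} (a₀ : Arrangement V k)
    (h₀ : G.conf a₀ = C) (v : V) : VertexClass G C where
  carrier a := {w | ∃ α π, EquivUnder G a₀ a.1 α π ∧ α v = w}
  isClass := by
    rintro ⟨a, ha⟩
    obtain ⟨β, ρ, hβ⟩ := conf_eq_iff.mp (h₀.trans ha.symm)
    refine ⟨β v, Set.ext fun w => ⟨?_, ?_⟩⟩
    · rintro ⟨α, π, h, rfl⟩
      exact ⟨_, _, hβ.symm.trans h, by simp⟩
    · rintro ⟨α, π, h, rfl⟩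
      exact ⟨_, _, hβ.trans h, rfl⟩
  equivariant := by
    rintro a₁ a₂ β ρ hβ
    refine Set.ext fun w => ⟨?_, ?_⟩
    · rintro ⟨_, ⟨α, π, h, rfl⟩, rfl⟩
      exact ⟨_, _, h.trans hβ, rfl⟩
    · rintro ⟨α, π, h, rfl⟩
      exact ⟨β⁻¹ (α v), ⟨_, _, h.trans hβ.symm, rfl⟩, by simp⟩

theorem yields_associatedAlgorithm {m : ℕ} (f : Fin m → Fin m) (x : Fin m) :
    Yields (associatedAlgorithm f) ((inducedNetwork f).conf fun _ => x)
      ((inducedNetwork f).conf fun _ => f x) := by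
  rintro ⟨a, ha⟩
  obtain ⟨α, π, h, e⟩ := conf_eq_iff.mp ha
  obtain rfl : a = fun _ => x := by
    rw [inducedNetwork_automorphism h] at e
    exact e
  exact ⟨fun _ => f x, rfl, fun r => ⟨Or.inr (Or.inl rfl), fun U hU => ⟨_, hU, rfl⟩⟩⟩

/-! ### Simulation by robots that follow a rigid family of arrangements. -/

section Embedding

variable {S : Type} {G : Network V} {k : ℕ}

/-- A family of arrangements is rigid if an equivalence between two of its members can only be
the trivial equivalence of a member with itself. -/
def IsRigid (G : Network V) (e : S → Arrangement V k) : Prop :=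
  ∀ s s' α π, EquivUnder G (e s) (e s') α π → s = s' ∧ α = 1

open Classical in
/-- The algorithm that moves the robots from the arrangement `e s` to the arrangement
`e (F s)`, and does not move them in all other configurations. -/
noncomputable def followingAlgorithm (F : S → S) (e : S → Arrangement V k) (he : IsRigid G e)
    (hF : ∀ s r, e s r = e (F s) r ∨ G.Adj (e s r) (e (F s) r)) : Algorithm G k where
  dest C U :=
    -- The class `U` is decoded to a state and a robot. Rigidity and injectivity of the arrangements
    -- make the decoded pair unique, so the arbitrary choice is harmless.
    if h : ∃ p : S × Fin k, ∃ hC : G.conf (e p.1) = C, e p.1 p.2 ∈ U.carrier ⟨e p.1, hC⟩ then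
      VertexClass.of G (e h.choose.1) h.choose_spec.choose (e (F h.choose.1) h.choose.2)
    else U
  reachable := by
    rintro C U ⟨a, ha⟩ u hu
    split_ifs with h
    · obtain ⟨hC, hU⟩ := h.choose_spec
      generalize h.choose = p at hC hU
      obtain ⟨α, π, hα⟩ := conf_eq_iff.mp (hC.trans ha.symm)
      refine ⟨α (e (F p.1) p.2), ⟨α, π, hα, rfl⟩, ?_⟩
      rw [← U.equivariant ⟨e p.1, hC⟩ ⟨a, ha⟩ α π hα] at hu
      obtain ⟨w, hw, rfl⟩ := hu
      obtain ⟨v, hv⟩ := U.isClass ⟨e p.1, hC⟩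
      rw [hv] at hU hw
      -- By rigidity the class is a singleton in `e p.1`, so `u` is the image under `α` of the
      -- vertex of robot `p.2`.
      obtain ⟨β, ρ, hβ, hβ'⟩ := hU
      obtain ⟨γ, τ, hγ, rfl⟩ := hw
      obtain rfl := (he _ _ _ _ hβ).2
      obtain rfl := (he _ _ _ _ hγ).2
      rw [Equiv.Perm.one_apply] at hβ'
      subst hβ'
      exact (hF p.1 p.2).imp (fun h => congrArg α h) fun h => (hα.1.1 _ _).mp h
    · exact ⟨u, hu, Or.inl rfl⟩

/-- All destination classes are singletons in `e s`, so no choice is left to the robots. Simulation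
quantifies over given executions, hence uniqueness of the successor suffices. -/
theorem eq_conf_of_yields_followingAlgorithm {F : S → S} {e : S → Arrangement V k}
    {he : IsRigid G e} {hF : ∀ s r, e s r = e (F s) r ∨ G.Adj (e s r) (e (F s) r)}
    (hinj : ∀ s, Function.Injective (e s)) {s : S} {C : Configuration G k}
    (h : Yields (followingAlgorithm F e he hF) (G.conf (e s)) C) : C = G.conf (e (F s)) := by
  obtain ⟨a, rfl, ha⟩ := h ⟨e s, rfl⟩
  congr 1
  funext r
  have hr := (ha r).2 (VertexClass.of G (e s) rfl (e s r)) ⟨1, 1, .refl G _, rfl⟩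
  have hex : ∃ p : S × Fin k, ∃ hC : G.conf (e p.1) = G.conf (e s),
      e p.1 p.2 ∈ (VertexClass.of G (e s) rfl (e s r)).carrier ⟨e p.1, hC⟩ :=
    ⟨(s, r), rfl, 1, 1, .refl G _, rfl⟩
  simp only [followingAlgorithm, dif_pos hex] at hr
  obtain ⟨α, π, hα, hr⟩ := hr
  obtain ⟨β, ρ, hβ, hβr⟩ := hex.choose_spec.choose_spec
  obtain ⟨h₁, rfl⟩ := he _ _ _ _ hα
  obtain ⟨h₂, rfl⟩ := he _ _ _ _ hβ
  rw [Equiv.Perm.one_apply, ← h₂] at hβr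
  have h₃ := hinj _ hβr
  exact hr.symm.trans (congrArg₂ (fun t q => e (F t) q) h₁ h₃.symm)

open Classical in
/-- A self-map `F` that is semiconjugate to `f`, and that can be followed by the robots on a
rigid family of arrangements, yields an algorithm that simulates `f`. -/
theorem computes_of_isRigid [Finite V] [NeZero k] {m : ℕ} [NeZero m] {f : Fin m → Fin m} {F : S → S}
    {φ : S → Fin m} (hφ : Function.Surjective φ) (hφF : Function.Semiconj φ F f)
    {e : S → Arrangement V k} (he : IsRigid G e) (hinj : ∀ s, Function.Injective (e s))
    (hF : ∀ s r, e s r = e (F s) r ∨ G.Adj (e s r) (e (F s) r)) :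
    Computes (fullySynchronousSystem G k) f := by
  let ψ : Configuration G k → Option (Configuration (inducedNetwork f) 1) := fun C =>
    if h : ∃ s, C = G.conf (e s) then some ((inducedNetwork f).conf fun _ => φ h.choose) else none
  have hψ (s : S) : ψ (G.conf (e s)) = some ((inducedNetwork f).conf fun _ => φ s) := by
    have h : ∃ s', G.conf (e s) = G.conf (e s') := ⟨s, rfl⟩
    obtain ⟨α, π, hα⟩ := conf_eq_iff.mp h.choose_spec
    simp only [ψ, dif_pos h, ← (he _ _ _ _ hα).1]
  refine ⟨followingAlgorithm F e he hF, ψ, fun D => ?_, fun E hE => ?_⟩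
  · obtain ⟨a, rfl⟩ : ∃ a : Arrangement (Fin m) 1, (inducedNetwork f).conf a = D :=
      Quotient.exists_rep D
    obtain ⟨s, hs⟩ := hφ (a 0)
    refine ⟨G.conf (e s), (hψ s).trans (congrArg some (congrArg _ ?_))⟩
    funext r
    rw [hs, Subsingleton.elim r 0]
  · by_cases h : ∃ s, E 0 = G.conf (e s)
    · obtain ⟨s, hs⟩ := h
      have hEs (i : ℕ) : E i = G.conf (e (F^[i] s)) := by
        induction i with
        | zero => exact hs
        | succ i ih =>
          rw [Function.iterate_succ_apply']
          refine eq_conf_of_yields_followingAlgorithm hinj (he := he) (hF := hF) ?_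
          rw [← ih]
          exact hE i
      refine ⟨fun i => (inducedNetwork f).conf fun _ => f^[i] (φ s), fun i => ?_, Or.inr
        ⟨id, monotone_id, Function.surjective_id, fun i => ?_⟩⟩
      · simp only [Function.iterate_succ_apply']
        exact yields_associatedAlgorithm f _
      · rw [hEs i]
        refine (hψ _).trans ?_
        rw [hφF.iterate_right i s]
        rfl
    -- The start encodes no state, so `ψ` is undefined there; some execution must still be supplied,
    -- and the orbit of 0 serves.
    · refine ⟨fun i => (inducedNetwork f).conf fun _ => f^[i] 0, fun i => ?_,
        Or.inl (dif_neg h)⟩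
      simp only [Function.iterate_succ_apply']
      exact yields_associatedAlgorithm f _

end Embedding

/-! ### Laying out the orbits on a line. -/

/-- Iteration of a self-map of a finite set is semiconjugate to a self-map of a set of integers
that moves every integer by at most two. -/
theorem exists_line_semiconj {m : ℕ} (f : Fin m → Fin m) :
    ∃ (S : Type) (F : S → S) (φ : S → Fin m) (pos : S → ℕ) (L : ℕ),
      Function.Surjective φ ∧ Function.Semiconj φ F f ∧ Function.Injective pos ∧
      (∀ s, pos s < L) ∧ ∀ s, pos s ≤ pos (F s) + 2 ∧ pos (F s) ≤ pos s + 2 := by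
  -- Two iterates coincide by pigeonhole; doubling the period makes it even, so that the cycle folds
  -- into two halves of length `d`.
  obtain ⟨a, d, hd, hf⟩ : ∃ a d, 0 < d ∧ f^[a + 2 * d] = f^[a] := by
    obtain ⟨a, b, hab, h⟩ := Finite.exists_ne_map_eq_of_infinite fun i : ℕ => f^[i]
    wlog hlt : a < b generalizing a b
    · exact this b a hab.symm h.symm (by omega)
    obtain ⟨d, rfl⟩ := Nat.exists_eq_add_of_lt hlt
    refine ⟨a, d + 1, d.succ_pos, ?_⟩
    replace h : f^[a + d + 1] = f^[a] := h.symm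
    rw [show a + 2 * (d + 1) = d + 1 + (a + d + 1) by ring, Function.iterate_add, h,
      ← Function.iterate_add, add_comm, ← add_assoc, h]
  -- Times before `a + d` go out along 0, 2, 4, …; the remaining `d` times return along odd integers
  -- from `2 * (a + d) - 1` down to `2 * a + 1`, next to the position `2 * a` of time `a`, where the
  -- cycle closes.
  let g : ℕ → ℕ := fun t => if t < a + d then 2 * t else 4 * (a + d) - 2 * t - 1
  have hg : ∀ t < a + 2 * d, g t < 2 * (a + d) := by
    intro t ht
    simp only [g]
    split_ifs <;> omega
  refine ⟨Fin m × Fin (a + 2 * d),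
    fun s => (s.1, if h : s.2.val + 1 < a + 2 * d then ⟨s.2.val + 1, h⟩ else ⟨a, by omega⟩),
    fun s => f^[s.2.val] s.1, fun s => s.1.val * (2 * (a + d)) + g s.2.val, m * (2 * (a + d)),
    fun x => ⟨(x, ⟨0, by omega⟩), rfl⟩, ?_, ?_, ?_, ?_⟩
  · rintro ⟨x, t, ht⟩
    simp only
    split_ifs with h
    · exact Function.iterate_succ_apply' f t x
    · have ht' : t + 1 = a + 2 * d := by omega
      rw [← Function.iterate_succ_apply' f t x, Nat.succ_eq_add_one, ht', hf]
  · rintro ⟨x, t, ht⟩ ⟨y, u, hu⟩ h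
    have h₁ := hg t ht
    have h₂ := hg u hu
    simp only at h
    have hdiv : ∀ (x : ℕ) {r : ℕ}, r < 2 * (a + d) →
        (x * (2 * (a + d)) + r) / (2 * (a + d)) = x := by
      intro x r hr
      rw [mul_comm, Nat.mul_add_div (by omega), Nat.div_eq_of_lt hr, add_zero]
    have hxy : x.val = y.val := by rw [← hdiv x h₁, ← hdiv y h₂, h]
    rw [hxy] at h
    have htu : g t = g u := by omega
    obtain rfl := Fin.ext hxy
    obtain rfl : t = u := by
      simp only [g] at htu
      split_ifs at htu <;> omega
    rfl
  · rintro ⟨x, t, ht⟩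
    calc _ < x.val * (2 * (a + d)) + 2 * (a + d) := Nat.add_lt_add_left (hg t ht) _
      _ = (x.val + 1) * (2 * (a + d)) := by ring
      _ ≤ _ := Nat.mul_le_mul_right _ x.isLt
  · rintro ⟨x, t, ht⟩
    simp only [g]
    split_ifs <;> simp only at * <;> omega

/-! ### Encoding an integer by the positions of the robots. -/

/-- The vertices of robots number `r = 0, 1, 2` that represent the integer `p < L`. -/
def coord (L r p : ℕ) : ℕ := if r = 0 then L - p / 2 else L + 1 + r + (p + 1) / 2

theorem coord_lt {L r p : ℕ} (hr : r < 3) (hp : p < L) : coord L r p < 2 * L + 4 := by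
  unfold coord
  split_ifs <;> omega

theorem coord_strictMono {L r r' p : ℕ} (h : r < r') : coord L r p < coord L r' p := by
  unfold coord
  split_ifs <;> omega

/-- Both `p / 2` and `(p + 1) / 2` change by at most 1 when `p` changes by at most 2. -/
theorem coord_step {L r p q : ℕ} (hpq : p ≤ q + 2) (hqp : q ≤ p + 2) :
    coord L r p = coord L r q ∨ coord L r p + 1 = coord L r q ∨
      coord L r q + 1 = coord L r p := by
  unfold coord
  split_ifs <;> omega

variable {S : Type} {k L : ℕ} {pos : S → ℕ}

/-- The arrangement of `k` robots, on a path or a ring with `4 * L + 16` vertices, that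
represents the integer `p < L`. -/
def lineArrangement (hk : k ≤ 3) {p : ℕ} (hp : p < L) : Arrangement (Fin (4 * L + 16)) k :=
  fun r => ⟨coord L r p, (coord_lt (r.isLt.trans_le hk) hp).trans (by omega)⟩

theorem lineArrangement_injective (hk : k ≤ 3) {p : ℕ} (hp : p < L) :
    Function.Injective (lineArrangement hk hp) := by
  intro r r' h
  have h' : coord L r p = coord L r' p := congrArg Fin.val h
  rcases lt_trichotomy r.val r'.val with hr | hr | hr
  · exact absurd h' (coord_strictMono hr).ne
  · exact Fin.ext hr
  · exact absurd h' (coord_strictMono hr).ne'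

/-- A graph on which the robots can follow the arrangements that represent integers. -/
theorem universal_of_isRigid [NeZero k] (hk : k ≤ 3) {P : ℕ → Prop} (hP : ∀ L, P (4 * L + 16))
    (H : ∀ n, SimpleGraph (Fin n)) (ℓ : ∀ n, Fin n → Fin n → ℕ)
    (hH : ∀ n (u v : Fin n), u.val + 1 = v.val → (H n).Adj u v)
    (hrigid : ∀ (S : Type) (L : ℕ) (pos : S → ℕ) (hpos : ∀ s, pos s < L), Function.Injective pos →
      IsRigid (ofSimpleGraph (H (4 * L + 16)) (ℓ _)) fun s => lineArrangement hk (hpos s)) :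
    Universal {Ψ | ∃ n : ℕ, P n ∧
      Ψ = fullySynchronousSystem (ofSimpleGraph (H n) (ℓ n)) k} := by
  intro m hm f
  have : NeZero m := ⟨by omega⟩
  obtain ⟨S, F, φ, pos, L, hφ, hφF, hinj, hpos, hF⟩ := exists_line_semiconj f
  refine ⟨_, ⟨4 * L + 16, hP L, rfl⟩, computes_of_isRigid hφ hφF (hrigid S L pos hpos hinj)
    (fun s => lineArrangement_injective hk _) fun s r => ?_⟩
  rcases coord_step (L := L) (r := r) (hF s).1 (hF s).2 with h | h | h
  · exact Or.inl (Fin.ext h)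
  · exact Or.inr (hH _ _ _ h)
  · exact Or.inr (hH _ _ _ h).symm

/-! ### Automorphisms of paths and cycles. -/

/-- A sequence with steps `±w` that never turns back is an arithmetic progression. -/
theorem arithmetic_of_step {R : Type} [AddCommGroup R] {g : ℕ → R} {w : R} {N : ℕ}
    (h₁ : ∀ u, u + 1 < N → g (u + 1) = g u + w ∨ g (u + 1) = g u - w)
    (h₂ : ∀ u, u + 2 < N → g (u + 2) ≠ g u) :
    (∀ u < N, g u = g 0 + u • w) ∨ ∀ u < N, g u = g 0 - u • w := by
  -- Stated for every `w` so that it also applies to `-w`.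
  have key : ∀ w : R, (∀ u, u + 1 < N → g (u + 1) = g u + w ∨ g (u + 1) = g u - w) →
      g 1 = g 0 + w → ∀ u < N, g u = g 0 + u • w := by
    intro w hw h0
    have step : ∀ u, u + 1 < N → g (u + 1) = g u + w := by
      intro u
      induction u with
      | zero => exact fun _ => h0
      | succ u ih =>
        intro hu
        refine (hw _ hu).resolve_right fun h => h₂ u hu ?_
        rw [h, ih (by omega), add_sub_cancel_right]
    intro u
    induction u with
    | zero => simp
    | succ u ih =>
      intro hu
      rw [step u hu, ih (by omega), succ_nsmul, add_assoc]
  by_cases hN : 1 < N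
  · rcases h₁ 0 hN with h | h
    · exact Or.inl (key w h₁ h)
    · right
      have := key (-w) (fun u hu => by simpa [sub_eq_add_neg] using (h₁ u hu).symm)
        (by rw [h, sub_eq_add_neg])
      intro u hu
      rw [this u hu, smul_neg, sub_eq_add_neg]
  · left
    intro u hu
    obtain rfl : u = 0 := by omega
    simp

/-- The images of consecutive vertices form a walk that never turns back, by injectivity, hence an
arithmetic progression in `ℤ`; having to fit into `n` vertices fixes its start. -/
theorem isAutomorphism_pathGraph {n : ℕ} {ℓ : Fin n → Fin n → ℕ} {α : Equiv.Perm (Fin n)}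
    (h : (ofSimpleGraph (SimpleGraph.pathGraph n) ℓ).IsAutomorphism α) :
    α = 1 ∨ ∀ u, (α u).val + u.val + 1 = n := by
  let g : ℕ → ℤ := fun u => if h : u < n then ((α ⟨u, h⟩).val : ℤ) else 0
  have hg (u : ℕ) (hu : u < n) : g u = (α ⟨u, hu⟩).val := dif_pos hu
  rcases n.eq_zero_or_pos with rfl | hn
  · exact Or.inl (Subsingleton.elim _ _)
  have hlast := hg (n - 1) (by omega)
  have hfirst := hg 0 hn
  have := (α ⟨0, hn⟩).isLt
  have := (α ⟨n - 1, by omega⟩).isLt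
  have h₁ : ∀ u, u + 1 < n → g (u + 1) = g u + 1 ∨ g (u + 1) = g u - 1 := by
    intro u hu
    have h' := (h.1 ⟨u, by omega⟩ ⟨u + 1, hu⟩).mp (SimpleGraph.pathGraph_adj.mpr (Or.inl rfl))
    have h'' := SimpleGraph.pathGraph_adj.mp h'
    rw [hg u (by omega), hg (u + 1) hu]
    omega
  have h₂ : ∀ u, u + 2 < n → g (u + 2) ≠ g u := by
    intro u hu
    rw [hg u (by omega), hg (u + 2) hu]
    intro h'
    have h'' := Fin.ext_iff.mp (α.injective (Fin.ext (Int.natCast_inj.mp h')))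
    simp at h''
  rcases arithmetic_of_step h₁ h₂ with H | H
  · left
    ext u
    have h₁ := H u u.isLt
    have h₂ := H (n - 1) (by omega)
    rw [hg u u.isLt, hfirst] at h₁
    rw [hlast, hfirst] at h₂
    simp only [nsmul_eq_mul, mul_one, Fin.eta] at h₁ h₂
    simp only [Equiv.Perm.one_apply]
    omega
  · right
    intro u
    have h₁ := H u u.isLt
    have h₂ := H (n - 1) (by omega)
    rw [hg u u.isLt, hfirst] at h₁
    rw [hlast, hfirst] at h₂
    simp only [nsmul_eq_mul, mul_one, Fin.eta] at h₁ h₂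
    omega

theorem cycleGraph_adj_iff_zmod {n : ℕ} (hn : 3 ≤ n) (u v : Fin n) :
    (SimpleGraph.cycleGraph n).Adj u v ↔
      ((v.val : ZMod n) = u.val + 1 ∨ (v.val : ZMod n) = u.val - 1) := by
  have key (u v : Fin n) : (u - v).val = 1 ↔ (u.val : ZMod n) = v.val + 1 := by
    rw [← Nat.cast_one (R := ZMod n), ← Nat.cast_add, ZMod.natCast_eq_natCast_iff',
      Nat.mod_eq_of_lt u.isLt]
    have := u.isLt
    have := v.isLt
    rw [Fin.sub_def]
    simp only
    rcases lt_or_ge (v.val + 1) n with h | h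
    · rw [Nat.mod_eq_of_lt h]
      rcases lt_or_ge u.val v.val with h' | h'
      · rw [Nat.mod_eq_of_lt (by omega)]
        omega
      · rw [show n - v.val + u.val = n + (u.val - v.val) by omega, Nat.add_mod_left,
          Nat.mod_eq_of_lt (by omega)]
        omega
    · rw [show v.val + 1 = n by omega, Nat.mod_self, show n - v.val + u.val = u.val + 1 by omega]
      rcases lt_or_ge (u.val + 1) n with h' | h'
      · rw [Nat.mod_eq_of_lt h']
        omega
      · rw [show u.val + 1 = n by omega, Nat.mod_self]
        omega
  rw [SimpleGraph.cycleGraph_adj', key, key, or_comm, eq_sub_iff_add_eq,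
    eq_comm (b := (v.val : ZMod n) + 1)]

/-- The argument for paths, carried out in `ZMod n`: the automorphism is a rotation or a reflection.
-/
theorem isAutomorphism_cycleGraph {n : ℕ} (hn : 3 ≤ n) {ℓ : Fin n → Fin n → ℕ}
    {α : Equiv.Perm (Fin n)}
    (h : (ofSimpleGraph (SimpleGraph.cycleGraph n) ℓ).IsAutomorphism α) :
    ∃ c : ℤ, (∀ u, (n : ℤ) ∣ (α u).val - (c + u.val)) ∨ ∀ u, (n : ℤ) ∣ (α u).val - (c - u.val) := by
  let g : ℕ → ZMod n := fun u => if h : u < n then ((α ⟨u, h⟩).val : ZMod n) else 0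
  have hg (u : ℕ) (hu : u < n) : g u = (α ⟨u, hu⟩).val := dif_pos hu
  refine ⟨(α ⟨0, by omega⟩).val, ?_⟩
  have h₁ : ∀ u, u + 1 < n → g (u + 1) = g u + 1 ∨ g (u + 1) = g u - 1 := by
    intro u hu
    have h' := (h.1 ⟨u, by omega⟩ ⟨u + 1, hu⟩).mp
      ((cycleGraph_adj_iff_zmod hn _ _).mpr (Or.inl (by simp)))
    rw [hg u (by omega), hg (u + 1) hu]
    exact (cycleGraph_adj_iff_zmod hn _ _).mp h'
  have h₂ : ∀ u, u + 2 < n → g (u + 2) ≠ g u := by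
    intro u hu
    rw [hg u (by omega), hg (u + 2) hu]
    intro h'
    rw [ZMod.natCast_eq_natCast_iff', Nat.mod_eq_of_lt (Fin.isLt _),
      Nat.mod_eq_of_lt (Fin.isLt _)] at h'
    have h'' := Fin.ext_iff.mp (α.injective (Fin.ext h'))
    simp at h''
  rcases arithmetic_of_step h₁ h₂ with H | H
  · refine Or.inl fun u => (ZMod.intCast_eq_intCast_iff_dvd_sub _ _ _).mp ?_
    have h₃ := H u u.isLt
    rw [hg u u.isLt, hg 0 (by omega)] at h₃
    simp [h₃]
  · refine Or.inr fun u => (ZMod.intCast_eq_intCast_iff_dvd_sub _ _ _).mp ?_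
    have h₃ := H u u.isLt
    rw [hg u u.isLt, hg 0 (by omega)] at h₃
    simp [h₃]

/-! ### Rigidity of the arrangements on paths and rings. -/

theorem EquivUnder.lineArrangement_val {G : Network (Fin (4 * L + 16))} {hk : k ≤ 3} {p q : ℕ}
    {hp : p < L} {hq : q < L} {α : Equiv.Perm (Fin (4 * L + 16))} {π : Equiv.Perm (Fin k)}
    (h : EquivUnder G (lineArrangement hk hp) (lineArrangement hk hq) α π) (r : Fin k) :
    (α (lineArrangement hk hp r)).val = coord L (π r) q :=
  congrArg Fin.val (congrFun h.2 r)

theorem isRigid_pathGraph (ℓ : Fin (4 * L + 16) → Fin (4 * L + 16) → ℕ)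
    (hpos : ∀ s, pos s < L) (hinj : Function.Injective pos) :
    IsRigid (ofSimpleGraph (SimpleGraph.pathGraph (4 * L + 16)) ℓ)
      fun s => lineArrangement (k := 2) (by omega) (hpos s) := by
  intro s s' α π h
  have hv := h.lineArrangement_val
  rcases isAutomorphism_pathGraph h.1 with rfl | H
  · refine ⟨hinj ?_, rfl⟩
    have h₀ : coord L 0 (pos s) = coord L (π 0) (pos s') := hv 0
    have h₁ : coord L 1 (pos s) = coord L (π 1) (pos s') := hv 1
    have hπ : π 0 ≠ π 1 := π.injective.ne (by decide)
    have := hpos s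
    have := hpos s'
    unfold coord at h₀ h₁
    split_ifs at h₀ h₁ <;> omega
  -- The reflection would move a robot out of the first `2 * L + 4` of the `4 * L + 16` vertices.
  · exfalso
    have h₁ := H (lineArrangement (k := 2) (by omega) (hpos s) 0)
    have h₂ : (lineArrangement (k := 2) (by omega) (hpos s) 0).val < 2 * L + 4 :=
      coord_lt (r := 0) (by omega) (hpos s)
    have h₃ : coord L (π 0) (pos s') < 2 * L + 4 := coord_lt (by omega) (hpos s')
    rw [hv 0] at h₁
    omega

/-- An equivalence between two of the arrangements in a ring preserves or reverses the signed
distances between the robots, and it is trivial if it preserves them and fixes a robot. -/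
theorem EquivUnder.cycleGraph_cases {ℓ : Fin (4 * L + 16) → Fin (4 * L + 16) → ℕ} {hk : k ≤ 3}
    {p q : ℕ} {hp : p < L} {hq : q < L} {α : Equiv.Perm (Fin (4 * L + 16))}
    {π : Equiv.Perm (Fin k)}
    (h : EquivUnder (ofSimpleGraph (SimpleGraph.cycleGraph (4 * L + 16)) ℓ)
      (lineArrangement hk hp) (lineArrangement hk hq) α π) :
    ((∀ r r' : Fin k, coord L (π r) q + coord L r' p = coord L (π r') q + coord L r p) ∧
      ∀ r : Fin k, coord L (π r) q = coord L r p → α = 1) ∨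
    ((∀ r r' : Fin k, coord L (π r) q + coord L r p = coord L (π r') q + coord L r' p) ∧
      ∃ c : ℤ, ∀ u, ((4 * L + 16 : ℕ) : ℤ) ∣ (α u).val - (c - u.val)) := by
  have hv := h.lineArrangement_val
  have hp' (r : Fin k) := coord_lt (L := L) (r.isLt.trans_le hk) hp
  have hq' (r : Fin k) := coord_lt (L := L) (r.isLt.trans_le hk) hq
  have hval (r : Fin k) : (lineArrangement hk hp r).val = coord L r p := rfl
  obtain ⟨c, H | H⟩ := isAutomorphism_cycleGraph (by omega) h.1
  · refine Or.inl ⟨fun r r' => ?_, fun r hr => ?_⟩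
    · have hd := dvd_sub (H (lineArrangement hk hp r)) (H (lineArrangement hk hp r'))
      rw [hv, hv, hval, hval] at hd
      have h₁ := hp' r
      have h₂ := hp' r'
      have h₃ := hq' (π r)
      have h₄ := hq' (π r')
      -- All coordinates are below `2 * L + 4`, so the quantity divisible by `4 * L + 16` is too
      -- small to be nonzero.
      have := Int.eq_zero_of_abs_lt_dvd hd (abs_lt.mpr (by constructor <;> omega))
      omega
    · ext u
      have hd := dvd_sub (H u) (H (lineArrangement hk hp r))
      rw [hv, hval, hr] at hd
      have h₁ := u.isLt
      have h₂ := (α u).isLt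
      have := Int.eq_zero_of_abs_lt_dvd hd (abs_lt.mpr (by constructor <;> omega))
      rw [Equiv.Perm.one_apply]
      omega
  · refine Or.inr ⟨fun r r' => ?_, c, H⟩
    have hd := dvd_sub (H (lineArrangement hk hp r)) (H (lineArrangement hk hp r'))
    rw [hv, hv, hval, hval] at hd
    have h₁ := hp' r
    have h₂ := hp' r'
    have h₃ := hq' (π r)
    have h₄ := hq' (π r')
    have := Int.eq_zero_of_abs_lt_dvd hd (abs_lt.mpr (by constructor <;> omega))
    omega

/-- The label of the edge from 0 to 1 forces the image of 1 to be one step clockwise of the image of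
0, while a reflection puts it one step counterclockwise; then `n` divides 2. -/
theorem not_isAutomorphism_orientedRing_of_reflection {n : ℕ} (hn : 3 ≤ n)
    {α : Equiv.Perm (Fin n)} {c : ℤ} (H : ∀ u, (n : ℤ) ∣ (α u).val - (c - u.val)) :
    ¬ (ofSimpleGraph (SimpleGraph.cycleGraph n) fun u v =>
      if v.val = (u.val + 1) % n then 1 else 0).IsAutomorphism α := by
  intro h
  let u₀ : Fin n := ⟨0, by omega⟩
  let u₁ : Fin n := ⟨1, by omega⟩
  have hlabel := h.2 u₀ u₁ ((cycleGraph_adj_iff_zmod hn _ _).mpr (Or.inl (by simp [u₀, u₁])))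
  simp only [ofSimpleGraph] at hlabel
  rw [if_pos (by simp [u₀, u₁, Nat.mod_eq_of_lt (show 1 < n by omega)])] at hlabel
  have h' : (α u₁).val = ((α u₀).val + 1) % n := by
    by_contra hne
    rw [if_neg hne] at hlabel
    omega
  have h₁ := dvd_sub (H u₁) (H u₀)
  have h₂ : (n : ℤ) ∣ ((α u₀).val + 1 : ℕ) - (α u₁).val := by
    rw [h']
    push_cast
    exact Int.dvd_self_sub_emod
  have h₃ := dvd_add h₁ h₂
  have h₄ : (α u₁).val - (c - u₁.val) - ((α u₀).val - (c - u₀.val)) +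
      (((α u₀).val + 1 : ℕ) - (α u₁).val) = (2 : ℤ) := by
    simp only [u₀, u₁]
    push_cast
    ring
  rw [h₄] at h₃
  have := Int.le_of_dvd (by norm_num) h₃
  omega

theorem isRigid_orientedRing (hpos : ∀ s, pos s < L) (hinj : Function.Injective pos) :
    IsRigid (ofSimpleGraph (SimpleGraph.cycleGraph (4 * L + 16)) fun u v =>
        if v.val = (u.val + 1) % (4 * L + 16) then 1 else 0)
      fun s => lineArrangement (k := 2) (by omega) (hpos s) := by
  intro s s' α π h
  rcases h.cycleGraph_cases with ⟨H, hα⟩ | ⟨-, c, H⟩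
  · have h₀ : coord L (π 0) (pos s') + coord L 1 (pos s) =
        coord L (π 1) (pos s') + coord L 0 (pos s) := H 0 1
    have hπ : π 0 ≠ π 1 := π.injective.ne (by decide)
    -- The signed distance from robot 0 to robot 1 is `pos + 2`: its sign rules out a swap and its
    -- value determines the state.
    have hs : pos s = pos s' ∧ π 0 = 0 := by
      unfold coord at h₀
      have := hpos s
      have := hpos s'
      split_ifs at h₀ <;> omega
    refine ⟨hinj hs.1, hα 0 ?_⟩
    rw [hs.1, hs.2]
  · exact absurd h.1 (not_isAutomorphism_orientedRing_of_reflection (by omega) H)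

theorem isRigid_unorientedRing (hpos : ∀ s, pos s < L) (hinj : Function.Injective pos) :
    IsRigid (ofSimpleGraph (SimpleGraph.cycleGraph (4 * L + 16)) fun _ _ => 0)
      fun s => lineArrangement (k := 3) (by omega) (hpos s) := by
  intro s s' α π h
  have hπ₁ : π 0 ≠ π 1 := π.injective.ne (by decide)
  have hπ₂ : π 0 ≠ π 2 := π.injective.ne (by decide)
  have hπ₃ : π 1 ≠ π 2 := π.injective.ne (by decide)
  have hp := hpos s
  have hq := hpos s'
  rcases h.cycleGraph_cases with ⟨H, hα⟩ | ⟨H, -⟩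
  · have h₁ : coord L (π 0) (pos s') + coord L 1 (pos s) =
        coord L (π 1) (pos s') + coord L 0 (pos s) := H 0 1
    have h₂ : coord L (π 1) (pos s') + coord L 2 (pos s) =
        coord L (π 2) (pos s') + coord L 1 (pos s) := H 1 2
    have hs : pos s = pos s' ∧ π 0 = 0 := by
      unfold coord at h₁ h₂
      split_ifs at h₁ h₂ <;> omega
    refine ⟨hinj hs.1, hα 0 ?_⟩
    rw [hs.1, hs.2]
  -- A reflection reverses the order of the robots, so it would match the gap 1 with a gap of at
  -- least 2.
  · exfalso
    have h₁ : coord L (π 0) (pos s') + coord L 0 (pos s) =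
        coord L (π 1) (pos s') + coord L 1 (pos s) := H 0 1
    have h₂ : coord L (π 1) (pos s') + coord L 1 (pos s) =
        coord L (π 2) (pos s') + coord L 2 (pos s) := H 1 2
    unfold coord at h₁ h₂
    split_ifs at h₁ h₂ <;> omega

end ObliviousRobots

open ObliviousRobots
theorem mainTheorem1 :
    Universal {Ψ | ∃ n : ℕ, 1 ≤ n ∧ Ψ = orientedPath n 2} ∧
    Universal {Ψ | ∃ n : ℕ, 1 ≤ n ∧ Ψ = unorientedPath n 2} ∧
    Universal {Ψ | ∃ n : ℕ, 3 ≤ n ∧ Ψ = orientedRing n 2} ∧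
    Universal {Ψ | ∃ n : ℕ, 3 ≤ n ∧ Ψ = unorientedRing n 3} := by
  have hpath (n : ℕ) (u v : Fin n) (h : u.val + 1 = v.val) : (SimpleGraph.pathGraph n).Adj u v :=
    SimpleGraph.pathGraph_adj.mpr (Or.inl h)
  have hcycle (n : ℕ) (u v : Fin n) (h : u.val + 1 = v.val) :
      (SimpleGraph.cycleGraph n).Adj u v :=
    SimpleGraph.pathGraph_le_cycleGraph (hpath n u v h)
  exact ⟨universal_of_isRigid (by omega) (fun _ => by omega) _ _ hpath
      fun _ _ _ hpos hinj => isRigid_pathGraph _ hpos hinj,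
    universal_of_isRigid (by omega) (fun _ => by omega) _ _ hpath
      fun _ _ _ hpos hinj => isRigid_pathGraph _ hpos hinj,
    universal_of_isRigid (by omega) (fun _ => by omega) _ _ hcycle
      fun _ _ _ hpos hinj => isRigid_orientedRing hpos hinj,
    universal_of_isRigid (by omega) (fun _ => by omega) _ _ hcycle
      fun _ _ _ hpos hinj => isRigid_unorientedRing hpos hinj⟩
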